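/- Let $\mathbb{D}\subset\mathbb{R}^2\cong\mathbb{C}$ be the open unit disk, with $z=x_1+ix_2$, and let $\|\cdot\|$ be the norm of the real space $L^2(\mathbb{D})$ (Lebesgue area measure). All derivatives of $L^2$-functions are taken in the sense of distributions on $\mathbb{D}$. Let $H^1(\mathbb{D})$ be the space of $f\in L^2(\mathbb{D})$ with $\partial f/\partial x_1,\partial f/\partial x_2\in L^2(\mathbb{D})$, normed by $\|f\|_1=\left(\|f\|^2+\|\partial f/\partial x_1\|^2+\|\partial f/\partial x_2\|^2\right)^{1/2}$. Let $P$ be the harmonic Bergman projection, that is, the orthogonal projection of $L^2(\mathbb{D})$ onto its closed subspace of square-integrable harmonic functions, and let $N=x_1\frac{\partial}{\partial x_1}+x_2\frac{\partial}{\partial x_2}=r\,\partial_r$. For integers $k\ge 0$ put $f_k(z)=\operatorname{Re}\left(z^{k+1}/|z|^k\right)$ for $z\neq 0$ and $f_k(0)=0$. Then, for every integer $k\ge 0$: $f_k\in L^2(\mathbb{D})$; $Nf_k=f_k$, both in the sense of distributions on $\mathbb{D}$ and classically at every $z\ne 0$; $\|f_k\|=\sqrt{\pi}/2$; and $$Pf_k(z)=2\,\frac{k+2}{k+4}\,\operatorname{Re}\left(z^{k+1}\right),$$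 in particular $Pf_k\in H^1(\mathbb{D})$. Moreover, there is no constant $C$ such that $$\|Pf_k\|_1\le C\left(\|Nf_k\|+\|f_k\|\right)\qquad\text{for all integers } k\ge 1.$$ Consequently, there is no constant $C$ such that $\|Pf\|_1\le C\left(\|Nf\|+\|f\|\right)$ holds for all $f\in L^2(\mathbb{D})$ with $Nf\in L^2(\mathbb{D})$ and $Pf\in H^1(\mathbb{D})$. -/

import Mathlib

open MeasureTheory Metric InnerProductSpace
open scoped ContDiff

noncomputable section

namespace HarmonicBergman

/-- The open unit disk; the plane is identified with `ℂ` by `z = x₁ + i x₂`. -/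
abbrev disk : Set ℂ := ball (0 : ℂ) 1

/-- The real Hilbert space `L²` of the disk, for the Euclidean area measure. -/
abbrev L2Disk : Type := Lp ℝ 2 ((volume : Measure ℂ).restrict disk)

/-- The space `h⁰` of square-integrable harmonic functions on the disk, inside `L²`. -/
def harmonicSpace : Submodule ℝ L2Disk where
  carrier := {f | ∃ u : ℂ → ℝ, HarmonicOnNhd u disk ∧ f =ᵐ[volume.restrict disk] u}
  zero_mem' := ⟨0, harmonicOnNhd_const 0, Lp.coeFn_zero _ _ _⟩
  add_mem' := by
    rintro f g ⟨u, hu, hfu⟩ ⟨v, hv, hgv⟩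
    exact ⟨u + v, hu.add hv, (Lp.coeFn_add f g).trans (hfu.add hgv)⟩
  smul_mem' := by
    rintro c f ⟨u, hu, hfu⟩
    exact ⟨c • u, hu.const_smul, (Lp.coeFn_smul c f).trans (hfu.const_smul c)⟩

/-! ### `h⁰` is a closed subspace, so that the orthogonal projection onto it exists -/

theorem harmonic_integral_ball {u : ℂ → ℝ} (hu : HarmonicOnNhd u disk) {z : ℂ} {ρ : ℝ}
    (hρ : 0 < ρ) (hz : closedBall z ρ ⊆ disk) :
    ∫ w in ball z ρ, u w = Real.pi * ρ ^ 2 * u z := by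
  have hmean : ∀ r ∈ Set.Ioo 0 ρ, ∫ θ in Set.Ioo (-Real.pi) Real.pi,
      r * u (circleMap z r θ) = r * (2 * Real.pi * u z) := by
    intro r hr
    have h1 : Real.circleAverage u z r = u z := by
      apply InnerProductSpace.HarmonicOnNhd.circleAverage_eq
      apply hu.mono
      rw [abs_of_pos hr.1]
      exact (closedBall_subset_closedBall hr.2.le).trans hz
    have hper : (fun θ ↦ u (circleMap z r θ)).Periodic (2 * Real.pi) :=
      fun x ↦ by simp [periodic_circleMap z r x]
    have h2 := hper.intervalIntegral_add_eq (-Real.pi) 0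
    rw [show -Real.pi + 2 * Real.pi = Real.pi by ring, zero_add] at h2
    rw [integral_const_mul, ← integral_Ioc_eq_integral_Ioo,
      ← intervalIntegral.integral_of_le (by linarith [Real.pi_pos]), h2]
    rw [Real.circleAverage_def, smul_eq_mul] at h1
    rw [← h1]
    field_simp
  have hmap : Continuous fun p : ℝ × ℝ ↦ circleMap z p.1 p.2 := by
    unfold circleMap; fun_prop
  have hint : IntegrableOn (fun p : ℝ × ℝ ↦ p.1 * u (circleMap z p.1 p.2))
      (Set.Ioo 0 ρ ×ˢ Set.Ioo (-Real.pi) Real.pi) := by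
    have : ContinuousOn (fun p : ℝ × ℝ ↦ p.1 * u (circleMap z p.1 p.2))
        (Set.Icc 0 ρ ×ˢ Set.Icc (-Real.pi) Real.pi) := by
      apply continuousOn_fst.mul
      apply hu.continuousOn.comp hmap.continuousOn
      rintro ⟨r, θ⟩ ⟨hr, -⟩
      apply hz
      simpa [circleMap, abs_of_nonneg hr.1] using hr.2
    exact (this.integrableOn_compact (isCompact_Icc.prod isCompact_Icc)).mono_set
      (Set.prod_mono Set.Ioo_subset_Icc_self Set.Ioo_subset_Icc_self)
  have key : ∫ w in ball z ρ, u w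
      = ∫ p in Set.Ioo 0 ρ ×ˢ Set.Ioo (-Real.pi) Real.pi, p.1 * u (circleMap z p.1 p.2) := by
    rw [← integral_indicator measurableSet_ball, ← integral_add_left_eq_self _ z,
      ← Complex.integral_comp_polarCoord_symm, polarCoord_target,
      ← integral_indicator (measurableSet_Ioi.prod measurableSet_Ioo),
      ← integral_indicator (measurableSet_Ioo.prod measurableSet_Ioo)]
    congr 1
    ext ⟨r, θ⟩
    have hc : z + Complex.polarCoord.symm (r, θ) = circleMap z r θ := by
      simp [circleMap, Complex.exp_mul_I]
    simp only [Set.indicator, Set.mem_prod, Set.mem_Ioi, Set.mem_Ioo, smul_eq_mul, hc]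
    by_cases h0 : 0 < r
    · by_cases h1 : r < ρ <;> simp [h0, h1, circleMap, abs_of_pos h0]
    · simp [h0]
  rw [key, Measure.volume_eq_prod, setIntegral_prod _ hint,
    setIntegral_congr_fun measurableSet_Ioo hmean, integral_mul_const,
    ← integral_Ioc_eq_integral_Ioo, ← intervalIntegral.integral_of_le hρ.le, integral_id]
  ring

theorem harmonic_eval_bound {R : ℝ} (hR : R < 1) :
    ∃ C : ℝ, ∀ (f : L2Disk) (u : ℂ → ℝ), HarmonicOnNhd u disk → f =ᵐ[volume.restrict disk] u →
      ∀ z ∈ closedBall (0 : ℂ) R, |u z| ≤ C * ‖f‖ := by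
  set ρ : ℝ := (1 - R) / 2 with hρd
  have hρ : 0 < ρ := by linarith
  set μ : Measure ℂ := volume.restrict disk with hμ
  have : IsFiniteMeasure μ :=
    isFiniteMeasure_restrict.2 measure_ball_lt_top.ne
  refine ⟨(Real.pi * ρ ^ 2)⁻¹ * (μ.real Set.univ) ^ (1 / (2 : ENNReal).toReal), ?_⟩
  intro f u hu hfu z hz
  have hsub : closedBall z ρ ⊆ disk := by
    intro w hw
    have h1 := dist_triangle w z 0
    simp only [mem_closedBall, mem_ball] at *
    linarith
  have h1 := harmonic_integral_ball hu hρ hsub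
  have hfin : μ (ball z ρ) ≠ ⊤ := measure_ne_top _ _
  have h2 := L2.inner_indicatorConstLp_one (𝕜 := ℝ) (μ := μ) measurableSet_ball hfin f
  have h3 : ∫ x in ball z ρ, f x ∂μ = ∫ w in ball z ρ, u w := by
    rw [Measure.restrict_restrict measurableSet_ball,
      Set.inter_eq_left.2 (ball_subset_closedBall.trans hsub)]
    apply integral_congr_ae
    exact ae_restrict_of_ae_restrict_of_subset (ball_subset_closedBall.trans hsub) hfu
  have h4 := abs_real_inner_le_norm (indicatorConstLp 2 measurableSet_ball hfin (1 : ℝ)) f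
  rw [h2, h3, h1, abs_mul, abs_of_pos (by positivity : 0 < Real.pi * ρ ^ 2)] at h4
  have h5 : ‖indicatorConstLp 2 measurableSet_ball hfin (1 : ℝ)‖
      ≤ (μ.real Set.univ) ^ (1 / (2 : ENNReal).toReal) := by
    refine norm_indicatorConstLp_le.trans ?_
    rw [norm_one, one_mul]
    exact Real.rpow_le_rpow measureReal_nonneg (measureReal_mono (Set.subset_univ _))
      (by positivity)
  rw [mul_assoc, inv_mul_eq_div, le_div_iff₀ (by positivity), mul_comm]
  exact h4.trans (mul_le_mul_of_nonneg_right h5 (norm_nonneg _))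

theorem isClosed_harmonicSpace : IsClosed (harmonicSpace : Set L2Disk) := by
  apply IsSeqClosed.isClosed
  intro F f hF hlim
  choose u hu hFu using hF
  have hcauchy : ∀ R < (1 : ℝ), UniformCauchySeqOn u Filter.atTop (closedBall (0 : ℂ) R) := by
    intro R hR
    obtain ⟨C, hC⟩ := harmonic_eval_bound hR
    rw [Metric.uniformCauchySeqOn_iff]
    intro ε hε
    obtain ⟨n₀, hn₀⟩ := Metric.cauchySeq_iff.1 hlim.cauchySeq (ε / (|C| + 1)) (by positivity)
    refine ⟨n₀, fun m hm n hn z hz ↦ ?_⟩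
    have h := hC (F m - F n) (u m - u n) ((hu m).sub (hu n))
      ((Lp.coeFn_sub _ _).trans ((hFu m).sub (hFu n))) z hz
    have h' := hn₀ m hm n hn
    rw [dist_eq_norm, lt_div_iff₀ (by positivity)] at h'
    rw [Real.dist_eq]
    refine lt_of_le_of_lt h ?_
    nlinarith [norm_nonneg (F m - F n), le_abs_self C]
  have hpt : ∀ z ∈ disk, ∃ l, Filter.Tendsto (fun n ↦ u n z) Filter.atTop (nhds l) := by
    intro z hz
    have hz' : ‖z‖ < 1 := by simpa using hz
    exact cauchySeq_tendsto_of_complete ((hcauchy ‖z‖ hz').cauchySeq (by simp))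
  choose! v hv using hpt
  have hvunif : ∀ R < (1 : ℝ), TendstoUniformlyOn u v Filter.atTop (closedBall (0 : ℂ) R) :=
    fun R hR ↦ (hcauchy R hR).tendstoUniformlyOn_of_tendsto
      fun z hz ↦ hv z (closedBall_subset_ball hR hz)
  refine ⟨v, ?_, ?_⟩
  · intro w₀ hw₀
    have hw₀' : ‖w₀‖ < 1 := by simpa using hw₀
    obtain ⟨R, hR₀, hR⟩ := exists_between hw₀'
    have hRpos : 0 < R := (norm_nonneg _).trans_lt hR₀
    have hsph : sphere (0 : ℂ) |R| ⊆ closedBall 0 R := by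
      rw [abs_of_pos hRpos]; exact sphere_subset_closedBall
    have hvc : ContinuousOn v (closedBall (0 : ℂ) R) :=
      (hvunif R hR).continuousOn (Filter.Frequently.of_forall fun n ↦
        (hu n).continuousOn.mono (closedBall_subset_ball hR))
    have hci : CircleIntegrable v 0 R := (hvc.mono hsph).circleIntegrable'
    have hci' : CircleIntegrable (fun ζ ↦ (v ζ : ℂ)) 0 R :=
      (Complex.continuous_ofReal.comp_continuousOn (hvc.mono hsph)).circleIntegrable'
    have han := analyticOnNhd_circleAverage_herglotzRieszKernel_smul hci'
    have heq : ∀ w ∈ ball (0 : ℂ) R, v w =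
        (Real.circleAverage (fun ζ ↦ herglotzRieszKernel 0 w ζ • (v ζ : ℂ)) 0 R).re := by
      intro w hw
      rw [re_circleAverage_herglotzRieszKernel_smul hci hw]
      have hk : Continuous fun θ ↦ (herglotzRieszKernel 0 w (circleMap 0 R θ)).re :=
        Complex.continuous_re.comp
          ((continuousOn_herglotzRieszKernel_sphere hw).comp_continuous (continuous_circleMap 0 R)
            fun θ ↦ circleMap_mem_sphere' 0 R θ)
      have h1 : ∀ n, u n w = Real.circleAverage
          ((Complex.re ∘ herglotzRieszKernel 0 w) • u n) 0 R := fun n ↦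
        (HarmonicOnNhd.circleAverage_re_herglotzRieszKernel_smul
          ((hu n).mono (closedBall_subset_ball hR)) hw).symm
      obtain ⟨C, hC⟩ := harmonic_eval_bound hR
      obtain ⟨M, hM⟩ := hlim.norm.bddAbove_range
      have hwd : w ∈ disk := ball_subset_ball hR.le hw
      refine tendsto_nhds_unique (hv w hwd) ?_
      simp_rw [h1, Real.circleAverage_def]
      apply Filter.Tendsto.const_smul
      refine intervalIntegral.tendsto_integral_filter_of_dominated_convergence
        (fun θ ↦ |(herglotzRieszKernel 0 w (circleMap 0 R θ)).re| * (|C| * M)) ?_ ?_ ?_ ?_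
      · refine Filter.Eventually.of_forall fun n ↦ ?_
        apply Continuous.aestronglyMeasurable
        refine hk.mul ((hu n).continuousOn.comp_continuous (continuous_circleMap 0 R) fun θ ↦ ?_)
        exact closedBall_subset_ball hR (hsph (circleMap_mem_sphere' 0 R θ))
      · refine Filter.Eventually.of_forall fun n ↦ Filter.Eventually.of_forall fun θ _ ↦ ?_
        have hb := hC (F n) (u n) (hu n) (hFu n) _ (hsph (circleMap_mem_sphere' 0 R θ))
        have hn : ‖F n‖ ≤ M := hM ⟨n, rfl⟩
        simp only [Pi.smul_apply', Function.comp_apply, smul_eq_mul, Real.norm_eq_abs, abs_mul]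
        refine mul_le_mul_of_nonneg_left (hb.trans ?_) (abs_nonneg _)
        exact (mul_le_mul_of_nonneg_right (le_abs_self C) (norm_nonneg _)).trans
          (mul_le_mul_of_nonneg_left hn (abs_nonneg _))
      · exact (hk.abs.mul continuous_const).intervalIntegrable _ _
      · refine Filter.Eventually.of_forall fun θ _ ↦ ?_
        exact (hv _ (closedBall_subset_ball hR
          (hsph (circleMap_mem_sphere' 0 R θ)))).const_mul _
    have hw₀R : w₀ ∈ ball (0 : ℂ) R := by simpa using hR₀
    refine (harmonicAt_congr_nhds ?_).2 (han w₀ hw₀R).harmonicAt_re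
    filter_upwards [isOpen_ball.mem_nhds hw₀R] with w hw using heq w hw
  · obtain ⟨ns, hns, hae⟩ := (tendstoInMeasure_of_tendsto_Lp hlim).exists_seq_tendsto_ae
    filter_upwards [hae, ae_all_iff.2 hFu, ae_restrict_mem measurableSet_ball] with z h1 h2 h3
    refine tendsto_nhds_unique h1 ?_
    simp_rw [h2]
    exact (hv z h3).comp hns.tendsto_atTop

instance : CompleteSpace harmonicSpace :=
  isClosed_harmonicSpace.completeSpace_coe

/-- The harmonic Bergman projection: the orthogonal projection of `L²` onto `h⁰`. -/
def P : L2Disk →L[ℝ] L2Disk := harmonicSpace.starProjection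

/-! ### Derivatives in the sense of distributions -/

/-- Real-valued smooth functions with compact support in the disk. -/
def IsTestFunction (φ : ℂ → ℝ) : Prop :=
  ContDiff ℝ ∞ φ ∧ HasCompactSupport φ ∧ tsupport φ ⊆ disk

/-- The divergence `∂₁Y₁ + ∂₂Y₂` of a vector field `Y = Y₁ + i Y₂`. -/
def divergence (Y : ℂ → ℂ) (z : ℂ) : ℝ :=
  (fderiv ℝ Y z 1).re + (fderiv ℝ Y z Complex.I).im

/-- For a smooth vector field `X = X₁ + i X₂`: the distributional derivative
`X₁ ∂₁f + X₂ ∂₂f` of `f ∈ L²` is (represented by) `g ∈ L²`. -/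
def HasDistribDeriv (X : ℂ → ℂ) (f g : L2Disk) : Prop :=
  ∀ φ : ℂ → ℝ, IsTestFunction φ →
    ∫ z in disk, g z * φ z = -∫ z in disk, f z * divergence (fun w ↦ φ w • X w) z

/-- The vector field `∂/∂x₁`. -/
def X₁ : ℂ → ℂ := fun _ ↦ 1

/-- The vector field `∂/∂x₂`. -/
def X₂ : ℂ → ℂ := fun _ ↦ Complex.I

/-- The vector field `N = x₁ ∂/∂x₁ + x₂ ∂/∂x₂ = r ∂/∂r`. -/
def N : ℂ → ℂ := fun z ↦ z

open Classical in
/-- The distributional derivative of `f` along `X` as an element of `L²`; it is meant for `f`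
such that this derivative belongs to `L²` (and is `0` for all other `f`). -/
def distribDeriv (X : ℂ → ℂ) (f : L2Disk) : L2Disk :=
  if h : ∃ g, HasDistribDeriv X f g then h.choose else 0

/-- `f` belongs to the Sobolev space `H¹` of the disk. -/
def MemH1 (f : L2Disk) : Prop :=
  (∃ g, HasDistribDeriv X₁ f g) ∧ ∃ g, HasDistribDeriv X₂ f g

/-- The Sobolev norm of order one, for `f` in `H¹`. -/
def sobolevNorm (f : L2Disk) : ℝ :=
  Real.sqrt (‖f‖ ^ 2 + ‖distribDeriv X₁ f‖ ^ 2 + ‖distribDeriv X₂ f‖ ^ 2)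

/-- The function `Re (z ^ (k + 1) / |z| ^ k)`, with the value `0` at `z = 0`. -/
def fk (k : ℕ) (z : ℂ) : ℝ := (z ^ (k + 1) / (‖z‖ : ℂ) ^ k).re

end HarmonicBergman

end

open HarmonicBergman

namespace HarmonicBergman

/-! ### Integration over the disk in polar coordinates -/

/-! In polar coordinates `fk k` is `r cos((k+1)θ)`: it oscillates fast in the angle but is
homogeneous of degree one in `r` whatever `k` is. So `N` fixes it, and its norm does not depend on
`k`. A harmonic function of the same angular frequency must instead carry the factor `r^(k+1)`, and
its gradient has norm of order `√k`. Projecting therefore trades a bounded radial derivative for an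
unbounded Sobolev norm.

The projection is found by testing against harmonic `u`. The `(k+1)`-st cosine coefficient of `u` on
the circle of radius `r` is a constant times `r^(k+1)` (`exists_circleAverage_harmonic_mul_pow_re`),
so orthogonality of `fk k - c Re z^(k+1)` to `u` reduces to one radial integral, which vanishes
exactly for `c = projCoeff k`, independently of `u`. Since `c ≥ 1`, the `x₁`-derivative alone makes
the squared Sobolev norm at least `π(k+1)/2`, while `‖N fk‖ + ‖fk‖ = √π`. -/

theorem integrableOn_polar {g : ℂ → ℝ} (hg : IntegrableOn g disk) :
    IntegrableOn (fun p : ℝ × ℝ ↦ p.1 * g (circleMap 0 p.1 p.2))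
      (Set.Ioo 0 1 ×ˢ Set.Ioo (-Real.pi) Real.pi) := by
  have h1 : Integrable (disk.indicator g) := (integrable_indicator_iff measurableSet_ball).2 hg
  have h2 : Integrable (disk.indicator g ∘ Complex.measurableEquivRealProd.symm) :=
    (Complex.volume_preserving_equiv_real_prod.symm.integrable_comp_emb
      Complex.measurableEquivRealProd.symm.measurableEmbedding).2 h1
  -- The Jacobian of polar coordinates is `r`; this transfers integrability, the hypothesis of
  -- Fubini, and not only the value of the integral.
  have h3 := (integrableOn_image_iff_integrableOn_abs_det_fderiv_smul volume
    polarCoord.open_target.measurableSet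
    (fun p _ ↦ (hasFDerivAt_polarCoord_symm p).hasFDerivWithinAt)
    polarCoord.symm.injOn (disk.indicator g ∘ Complex.measurableEquivRealProd.symm)).1
    h2.integrableOn
  have hsub : Set.Ioo (0 : ℝ) 1 ×ˢ Set.Ioo (-Real.pi) Real.pi ⊆ polarCoord.target := by
    rw [polarCoord_target]
    exact Set.prod_mono Set.Ioo_subset_Ioi_self subset_rfl
  refine (h3.mono_set hsub).congr_fun ?_ (measurableSet_Ioo.prod measurableSet_Ioo)
  rintro ⟨r, θ⟩ ⟨hr, -⟩
  have hr : 0 < r ∧ r < 1 := hr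
  have hc : Complex.measurableEquivRealProd.symm (polarCoord.symm (r, θ)) = circleMap 0 r θ := by
    rw [Complex.measurableEquivRealProd_symm_polarCoord_symm_apply]
    simp [circleMap, Complex.exp_mul_I]
  have hm : circleMap 0 r θ ∈ disk := by simp [circleMap, abs_of_pos hr.1, hr.2]
  simp only [det_fderivPolarCoordSymm, Function.comp_apply, hc, Set.indicator_of_mem hm,
    smul_eq_mul, abs_of_pos hr.1]

theorem integral_disk_eq_integral_prod (g : ℂ → ℝ) :
    ∫ z in disk, g z = ∫ p in Set.Ioo 0 1 ×ˢ Set.Ioo (-Real.pi) Real.pi,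
      p.1 * g (circleMap 0 p.1 p.2) := by
  rw [← integral_indicator measurableSet_ball,
    ← Complex.integral_comp_polarCoord_symm, polarCoord_target,
    ← integral_indicator (measurableSet_Ioi.prod measurableSet_Ioo),
    ← integral_indicator (measurableSet_Ioo.prod measurableSet_Ioo)]
  congr 1
  ext ⟨r, θ⟩
  have hc : Complex.polarCoord.symm (r, θ) = circleMap 0 r θ := by
    simp [circleMap, Complex.exp_mul_I]
  simp only [Set.indicator, Set.mem_prod, Set.mem_Ioi, Set.mem_Ioo, smul_eq_mul, hc]
  by_cases h0 : 0 < r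
  · by_cases h1 : r < 1 <;> simp [h0, h1, circleMap, abs_of_pos h0]
  · simp [h0]

theorem integral_disk_polar {g : ℂ → ℝ} (hg : IntegrableOn g disk) :
    ∫ z in disk, g z = ∫ r in Set.Ioo (0 : ℝ) 1, ∫ θ in Set.Ioo (-Real.pi) Real.pi,
      r * g (circleMap 0 r θ) := by
  rw [integral_disk_eq_integral_prod, Measure.volume_eq_prod,
    setIntegral_prod _ (integrableOn_polar hg)]

/-- Integrating along each ray first is what allows a radial integration by parts. -/
theorem integral_disk_polar_swap {g : ℂ → ℝ} (hg : IntegrableOn g disk) :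
    ∫ z in disk, g z = ∫ θ in Set.Ioo (-Real.pi) Real.pi, ∫ r in Set.Ioo (0 : ℝ) 1,
      r * g (circleMap 0 r θ) := by
  rw [integral_disk_polar hg]
  refine integral_integral_swap ?_
  rw [Measure.prod_restrict]
  exact integrableOn_polar hg

theorem integral_Ioo_pow (m : ℕ) : ∫ r in Set.Ioo (0 : ℝ) 1, r ^ m = 1 / ((m : ℝ) + 1) := by
  rw [← integral_Ioc_eq_integral_Ioo, ← intervalIntegral.integral_of_le zero_le_one,
    integral_pow]
  simp

theorem integral_cos_mul_sq {n : ℕ} (hn : n ≠ 0) :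
    ∫ θ in Set.Ioo (-Real.pi) Real.pi, Real.cos (n * θ) ^ 2 = Real.pi := by
  rw [← integral_Ioc_eq_integral_Ioo,
    ← intervalIntegral.integral_of_le (by linarith [Real.pi_pos]),
    intervalIntegral.integral_comp_mul_left (fun x ↦ Real.cos x ^ 2) (by exact_mod_cast hn),
    integral_cos_sq]
  have h : Real.sin (n * Real.pi) = 0 := Real.sin_nat_mul_pi n
  have hn' : (n : ℝ) ≠ 0 := by exact_mod_cast hn
  simp only [mul_neg, Real.sin_neg, h, smul_eq_mul]
  field_simp
  ring

instance : IsFiniteMeasure ((volume : Measure ℂ).restrict disk) :=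
  isFiniteMeasure_restrict.2 measure_ball_lt_top.ne

theorem norm_sq_toLp {g : ℂ → ℝ} (hg : MemLp g 2 (volume.restrict disk)) :
    ‖hg.toLp g‖ ^ 2 = ∫ z in disk, g z ^ 2 := by
  rw [← real_inner_self_eq_norm_sq, L2.inner_def]
  refine integral_congr_ae ?_
  filter_upwards [hg.coeFn_toLp] with z hz
  rw [hz]
  simp [pow_two]

/-- The radial factor is `∫ r^(2m+1) dr = 1/(2m+2)` and the angular one is `π`. It serves `fk k`
with `m = 1`, `n = k+1`, and `Re z^k` with `m = n = k`. -/
theorem norm_sq_toLp_of_polar {g : ℂ → ℝ} (hg : MemLp g 2 (volume.restrict disk)) {m n : ℕ}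
    (hn : n ≠ 0)
    (h : ∀ r ∈ Set.Ioo (0 : ℝ) 1, ∀ θ, g (circleMap 0 r θ) = r ^ m * Real.cos (n * θ)) :
    ‖hg.toLp g‖ ^ 2 = Real.pi / (2 * (m : ℝ) + 2) := by
  rw [norm_sq_toLp, integral_disk_polar hg.integrable_sq]
  have : ∀ r ∈ Set.Ioo (0 : ℝ) 1, ∫ θ in Set.Ioo (-Real.pi) Real.pi,
      r * g (circleMap 0 r θ) ^ 2 = r ^ (2 * m + 1) * Real.pi := by
    intro r hr
    have e : ∀ θ, r * g (circleMap 0 r θ) ^ 2 = r ^ (2 * m + 1) * Real.cos (n * θ) ^ 2 := by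
      intro θ
      rw [h r hr θ]
      ring
    simp_rw [e]
    rw [integral_const_mul, integral_cos_mul_sq hn]
  rw [setIntegral_congr_fun measurableSet_Ioo this, integral_mul_const, integral_Ioo_pow]
  push_cast
  ring

/-! ### The functions `fk` and `Re (z ^ m)` -/

theorem circleMap_zero_pow_re (r θ : ℝ) (m : ℕ) :
    (circleMap 0 r θ ^ m).re = r ^ m * Real.cos (m * θ) := by
  have : circleMap 0 r θ ^ m = ((r ^ m : ℝ) : ℂ) * Complex.exp (((m * θ : ℝ) : ℂ) * Complex.I) := by
    simp only [circleMap, zero_add, mul_pow, ← Complex.exp_nat_mul]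
    push_cast
    ring_nf
  rw [this, Complex.re_ofReal_mul, Complex.exp_ofReal_mul_I_re]

/-- At the origin division by zero yields `0` when `k ≥ 1`, so this formula also covers the
prescribed value there. -/
theorem fk_eq (k : ℕ) (z : ℂ) : fk k z = (z ^ (k + 1)).re / ‖z‖ ^ k := by
  rw [fk, ← Complex.ofReal_pow, Complex.div_ofReal_re]

theorem fk_circleMap (k : ℕ) {r : ℝ} (hr : 0 < r) (θ : ℝ) :
    fk k (circleMap 0 r θ) = r ^ 1 * Real.cos ((k + 1 : ℕ) * θ) := by
  rw [fk_eq, circleMap_zero_pow_re, norm_circleMap_zero, abs_of_pos hr]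
  field_simp
  ring

theorem fk_smul (k : ℕ) {t : ℝ} (ht : 0 < t) (z : ℂ) : fk k (t • z) = t * fk k z := by
  rw [fk_eq, fk_eq, norm_smul, Real.norm_of_nonneg ht.le, smul_pow, Complex.smul_re,
    smul_eq_mul, mul_pow, pow_succ, mul_assoc, mul_div_mul_left _ _ (by positivity), mul_div_assoc]

theorem abs_fk_le (k : ℕ) (z : ℂ) : |fk k z| ≤ ‖z‖ := by
  rw [fk_eq, abs_div, abs_of_nonneg (by positivity : 0 ≤ ‖z‖ ^ k)]
  refine div_le_of_le_mul₀ (by positivity) (by positivity) ?_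
  calc |(z ^ (k + 1)).re| ≤ ‖z ^ (k + 1)‖ := Complex.abs_re_le_norm _
    _ = ‖z‖ * ‖z‖ ^ k := by rw [norm_pow, pow_succ']

theorem memLp_fk (k : ℕ) : MemLp (fk k) 2 (volume.restrict disk) := by
  have hm : Measurable (fk k) := by
    unfold fk
    fun_prop
  refine MemLp.of_bound hm.aestronglyMeasurable 1 ?_
  filter_upwards [ae_restrict_mem measurableSet_ball] with z hz
  have hz : ‖z‖ < 1 := by simpa using hz
  exact (abs_fk_le k z).trans hz.le

theorem memLp_of_continuous {g : ℂ → ℝ} (hg : Continuous g) :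
    MemLp g 2 (volume.restrict disk) := by
  obtain ⟨C, hC⟩ := (isCompact_closedBall (0 : ℂ) 1).exists_bound_of_continuousOn hg.continuousOn
  refine MemLp.of_bound hg.aestronglyMeasurable C ?_
  filter_upwards [ae_restrict_mem measurableSet_ball] with z hz
  exact hC z (ball_subset_closedBall hz)

theorem differentiableAt_fk (k : ℕ) {z : ℂ} (hz : z ≠ 0) : DifferentiableAt ℝ (fk k) z := by
  have h1 : DifferentiableAt ℝ (fun w : ℂ ↦ ‖w‖) z := differentiableAt_id.norm ℝ hz
  have h2 : DifferentiableAt ℝ (fun w : ℂ ↦ (w ^ (k + 1)).re) z :=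
    Complex.reCLM.differentiableAt.comp z (differentiableAt_pow (𝕜 := ℝ) (k + 1))
  have : fk k = fun w ↦ (w ^ (k + 1)).re * (‖w‖ ^ k)⁻¹ :=
    funext fun w ↦ by rw [fk_eq, div_eq_mul_inv]
  rw [this]
  exact h2.mul ((h1.fun_pow k).fun_inv (pow_ne_zero _ (norm_ne_zero_iff.2 hz)))

/-- Euler's identity for a function homogeneous of degree one: differentiate `t ↦ fk k (t z)` at `t
= 1` by the chain rule and by homogeneity. -/
theorem fderiv_fk_self (k : ℕ) {z : ℂ} (hz : z ≠ 0) : fderiv ℝ (fk k) z z = fk k z := by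
  have h1 : HasDerivAt (fun t : ℝ ↦ t • z) z 1 := by
    simpa using (hasDerivAt_id (1 : ℝ)).smul_const z
  have hd : HasFDerivAt (fk k) (fderiv ℝ (fk k) z) ((1 : ℝ) • z) := by
    simpa using (differentiableAt_fk k hz).hasFDerivAt
  have h2 : HasDerivAt (fun t : ℝ ↦ fk k (t • z)) (fderiv ℝ (fk k) z z) 1 :=
    HasFDerivAt.comp_hasDerivAt (f := fun t : ℝ ↦ t • z) (l := fk k) 1 hd h1
  have h3 : HasDerivAt (fun t : ℝ ↦ fk k (t • z)) (fk k z) 1 := by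
    have : HasDerivAt (fun t : ℝ ↦ t * fk k z) (fk k z) 1 := by
      simpa using (hasDerivAt_id (1 : ℝ)).mul_const (fk k z)
    refine this.congr_of_eventuallyEq ?_
    filter_upwards [lt_mem_nhds zero_lt_one] with t ht using fk_smul k ht z
  exact h2.unique h3

theorem norm_sq_fk (k : ℕ) : ‖(memLp_fk k).toLp (fk k)‖ ^ 2 = Real.pi / 4 := by
  rw [norm_sq_toLp_of_polar (memLp_fk k) k.succ_ne_zero
    (fun r hr θ ↦ fk_circleMap k hr.1 θ)]
  norm_num

theorem norm_fk (k : ℕ) : ‖(memLp_fk k).toLp (fk k)‖ = Real.sqrt Real.pi / 2 := by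
  rw [← Real.sqrt_sq (norm_nonneg ((memLp_fk k).toLp (fk k))), norm_sq_fk,
    Real.sqrt_div Real.pi_pos.le, show (4 : ℝ) = 2 ^ 2 by norm_num, Real.sqrt_sq zero_le_two]

/-! ### Distributional derivatives -/

/-- The fundamental lemma of the calculus of variations. It makes the choice in `distribDeriv`
harmless. -/
theorem HasDistribDeriv.unique {X : ℂ → ℂ} {f g g' : L2Disk} (h : HasDistribDeriv X f g)
    (h' : HasDistribDeriv X f g') : g = g' := by
  have hint : ∀ g : L2Disk, IntegrableOn g disk := fun g ↦ (Lp.memLp g).integrable one_le_two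
  have hmul : ∀ (g : L2Disk) (φ : ℂ → ℝ), IsTestFunction φ →
      IntegrableOn (fun z ↦ g z * φ z) disk := fun g φ hφ ↦
    (Lp.memLp g).integrable_mul (memLp_of_continuous hφ.1.continuous)
  have key := isOpen_ball.ae_eq_zero_of_integral_contDiff_smul_eq_zero (U := disk)
    (f := fun z ↦ g z - g' z) (μ := volume) ((hint g).sub (hint g')).locallyIntegrableOn ?_
  · refine Lp.ext ((ae_restrict_iff' measurableSet_ball).2 ?_)
    filter_upwards [key] with z hz hzd using sub_eq_zero.1 (hz hzd)
  · intro φ hφ hc hs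
    have ht : IsTestFunction φ := ⟨hφ, hc, hs⟩
    have e : ∫ z, φ z • (g z - g' z) = ∫ z in disk, (g z * φ z - g' z * φ z) := by
      rw [← setIntegral_eq_integral_of_forall_compl_eq_zero (s := disk)]
      · refine integral_congr_ae (.of_forall fun z ↦ ?_)
        simp only [smul_eq_mul]
        ring
      · intro z hz
        rw [image_eq_zero_of_notMem_tsupport fun hz' ↦ hz (hs hz'), zero_smul]
    rw [e, integral_sub (hmul g φ ht) (hmul g' φ ht), h φ ht, h' φ ht, sub_self]

theorem HasDistribDeriv.distribDeriv_eq {X : ℂ → ℂ} {f g : L2Disk} (h : HasDistribDeriv X f g) :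
    distribDeriv X f = g := by
  have he : ∃ g, HasDistribDeriv X f g := ⟨g, h⟩
  rw [distribDeriv, dif_pos he]
  exact he.choose_spec.unique h

theorem divergence_smul_const {φ : ℂ → ℝ} {z : ℂ} (hφ : DifferentiableAt ℝ φ z) (v : ℂ) :
    divergence (fun w ↦ φ w • v) z = fderiv ℝ φ z v := by
  have h : HasFDerivAt (fun w ↦ φ w • v) ((fderiv ℝ φ z).smulRight v) z :=
    hφ.hasFDerivAt.smul_const v
  have hv : v = v.re • (1 : ℂ) + v.im • Complex.I := by simp [Complex.re_add_im]
  conv_rhs => rw [hv, map_add, map_smul, map_smul]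
  rw [divergence, h.fderiv]
  simp [mul_comm]

theorem divergence_smul_id {φ : ℂ → ℝ} {z : ℂ} (hφ : DifferentiableAt ℝ φ z) :
    divergence (fun w ↦ φ w • w) z = 2 * φ z + fderiv ℝ φ z z := by
  have h := hφ.hasFDerivAt.smul (hasFDerivAt_id (𝕜 := ℝ) z)
  have hv : z = z.re • (1 : ℂ) + z.im • Complex.I := by simp [Complex.re_add_im]
  have e : fderiv ℝ φ z z = z.re * fderiv ℝ φ z 1 + z.im * fderiv ℝ φ z Complex.I := by
    have := congrArg (fderiv ℝ φ z) hv
    rwa [map_add, map_smul, map_smul, smul_eq_mul, smul_eq_mul] at this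
  have h' : fderiv ℝ (fun w ↦ φ w • w) z = _ := h.fderiv
  rw [divergence, h', e]
  simp
  ring

/-- A `C¹` function on the plane has its classical partial derivatives as distributional
derivatives on the disk. -/
theorem hasDistribDeriv_const_of_contDiff {u : ℂ → ℝ} (hu : ContDiff ℝ 1 u) (v : ℂ)
    {f g : L2Disk} (hf : f =ᵐ[volume.restrict disk] u)
    (hg : g =ᵐ[volume.restrict disk] fun z ↦ fderiv ℝ u z v) :
    HasDistribDeriv (fun _ ↦ v) f g := by
  rintro φ ⟨hφ, hc, hs⟩
  have hd : Differentiable ℝ φ := hφ.differentiable (by simp)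
  have hu' : Continuous fun z ↦ fderiv ℝ u z v :=
    (hu.continuous_fderiv one_ne_zero).clm_apply continuous_const
  have hφ' : Continuous fun z ↦ fderiv ℝ φ z v :=
    (hφ.continuous_fderiv (by simp)).clm_apply continuous_const
  have hc' : HasCompactSupport fun z ↦ fderiv ℝ φ z v := hc.fderiv_apply ℝ v
  -- The test function is supported in the disk, so both integrals extend to the whole plane, where
  -- integration by parts has no boundary term.
  have e1 : ∫ z in disk, g z * φ z = ∫ z, fderiv ℝ u z v * φ z := by
    refine Eq.trans ?_ (setIntegral_eq_integral_of_forall_compl_eq_zero (s := disk) ?_)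
    · refine integral_congr_ae ?_
      filter_upwards [hg] with z hz
      rw [hz]
    · intro z hz
      rw [image_eq_zero_of_notMem_tsupport fun hz' ↦ hz (hs hz'), mul_zero]
  have e2 : ∫ z in disk, f z * divergence (fun w ↦ φ w • v) z = ∫ z, u z * fderiv ℝ φ z v := by
    refine Eq.trans ?_ (setIntegral_eq_integral_of_forall_compl_eq_zero (s := disk) ?_)
    · refine integral_congr_ae ?_
      filter_upwards [hf] with z hz
      rw [hz, divergence_smul_const (hd z)]
    · intro z hz
      have : z ∉ tsupport (fderiv ℝ φ) := fun hz' ↦ hz (hs (tsupport_fderiv_subset ℝ hz'))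
      rw [image_eq_zero_of_notMem_tsupport this]
      simp
  rw [e1, e2, integral_mul_fderiv_eq_neg_fderiv_mul_of_integrable
    ((hu'.mul hφ.continuous).integrable_of_hasCompactSupport hc.mul_left)
    ((hu.continuous.mul hφ').integrable_of_hasCompactSupport hc'.mul_left)
    ((hu.continuous.mul hφ.continuous).integrable_of_hasCompactSupport hc.mul_left)
    (fun x _ ↦ hu.differentiable one_ne_zero x) (fun x _ ↦ hd x), neg_neg]

/-- The integrand is the `r`-derivative of `r³ φ(r e^{iθ})`, which vanishes at `0` because of `r³`
and at `1` because `φ` is supported in the open disk. -/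
theorem integral_Ioo_radial {φ : ℂ → ℝ} (hφ : ContDiff ℝ 1 φ) (hs : tsupport φ ⊆ disk) (θ : ℝ) :
    ∫ r in Set.Ioo (0 : ℝ) 1, (3 * r ^ 2 * φ (circleMap 0 r θ) +
      r ^ 2 * fderiv ℝ φ (circleMap 0 r θ) (circleMap 0 r θ)) = 0 := by
  set e : ℂ := Complex.exp (θ * Complex.I) with he
  have hcm : ∀ r : ℝ, circleMap 0 r θ = r • e := fun r ↦ by simp [circleMap, he]
  have hd : ∀ r : ℝ, HasDerivAt (fun r : ℝ ↦ r ^ 3 * φ (r • e))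
      (3 * r ^ 2 * φ (r • e) + r ^ 2 * fderiv ℝ φ (r • e) (r • e)) r := by
    intro r
    have h1 : HasDerivAt (fun t : ℝ ↦ t • e) e r := by
      simpa using (hasDerivAt_id r).smul_const e
    have h2 : HasDerivAt (fun t : ℝ ↦ φ (t • e)) (fderiv ℝ φ (r • e) e) r :=
      ((hφ.differentiable one_ne_zero (r • e)).hasFDerivAt).comp_hasDerivAt r h1
    refine ((hasDerivAt_pow 3 r).mul h2).congr_deriv ?_
    rw [map_smul, smul_eq_mul]
    push_cast
    ring
  have hcont : Continuous fun r : ℝ ↦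
      3 * r ^ 2 * φ (r • e) + r ^ 2 * fderiv ℝ φ (r • e) (r • e) := by
    have h1 : Continuous fun r : ℝ ↦ r • e := by fun_prop
    have h2 := hφ.continuous.comp h1
    have h3 := ((hφ.continuous_fderiv one_ne_zero).comp h1).clm_apply h1
    exact ((by fun_prop : Continuous fun r : ℝ ↦ 3 * r ^ 2).mul h2).add
      ((by fun_prop : Continuous fun r : ℝ ↦ r ^ 2).mul h3)
  have h0 : φ ((1 : ℝ) • e) = 0 := by
    refine image_eq_zero_of_notMem_tsupport fun h ↦ ?_
    have := hs h
    simp [he, Complex.norm_exp_ofReal_mul_I] at this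
  simp_rw [hcm]
  rw [← integral_Ioc_eq_integral_Ioo, ← intervalIntegral.integral_of_le zero_le_one,
    intervalIntegral.integral_eq_sub_of_hasDerivAt (fun r _ ↦ hd r)
      (hcont.intervalIntegrable _ _), h0]
  simp

/-- On a ray, the area element and `fk k` each contribute a factor `r`, and `φ + (2φ + Nφ) = 3φ +
Nφ`, so the radial integral is that of `integral_Ioo_radial`. No derivative of `fk k` is taken,
hence its singularity at the origin plays no role. -/
theorem hasDistribDeriv_N_fk (k : ℕ) :
    HasDistribDeriv N ((memLp_fk k).toLp (fk k)) ((memLp_fk k).toLp (fk k)) := by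
  rintro φ ⟨hφ, hc, hs⟩
  have hd : Differentiable ℝ φ := hφ.differentiable (by simp)
  have hφ1 : ContDiff ℝ 1 φ := hφ.of_le (by exact_mod_cast le_top)
  have hφ' : Continuous fun z ↦ fderiv ℝ φ z z :=
    (hφ.continuous_fderiv (by simp)).clm_apply continuous_id
  have e1 : ∫ z in disk, (memLp_fk k).toLp (fk k) z * φ z = ∫ z in disk, fk k z * φ z := by
    refine integral_congr_ae ?_
    filter_upwards [(memLp_fk k).coeFn_toLp] with z hz
    rw [hz]
  have e2 : ∫ z in disk, (memLp_fk k).toLp (fk k) z * divergence (fun w ↦ φ w • N w) z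
      = ∫ z in disk, fk k z * (2 * φ z + fderiv ℝ φ z z) := by
    refine integral_congr_ae ?_
    filter_upwards [(memLp_fk k).coeFn_toLp] with z hz
    rw [hz, ← divergence_smul_id (hd z)]
    rfl
  have i1 : IntegrableOn (fun z ↦ fk k z * φ z) disk :=
    (memLp_fk k).integrable_mul (memLp_of_continuous hφ.continuous)
  have i2 : IntegrableOn (fun z ↦ fk k z * (2 * φ z + fderiv ℝ φ z z)) disk :=
    (memLp_fk k).integrable_mul
      (memLp_of_continuous ((continuous_const.mul hφ.continuous).add hφ'))
  have h0 : ∫ z in disk, (fk k z * φ z + fk k z * (2 * φ z + fderiv ℝ φ z z)) = 0 := by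
    rw [integral_disk_polar_swap (by exact i1.add i2)]
    refine integral_eq_zero_of_ae (.of_forall fun θ ↦ ?_)
    have : ∀ r ∈ Set.Ioo (0 : ℝ) 1, r * (fk k (circleMap 0 r θ) * φ (circleMap 0 r θ) +
        fk k (circleMap 0 r θ) * (2 * φ (circleMap 0 r θ) +
          fderiv ℝ φ (circleMap 0 r θ) (circleMap 0 r θ)))
        = Real.cos ((k + 1 : ℕ) * θ) * (3 * r ^ 2 * φ (circleMap 0 r θ) +
          r ^ 2 * fderiv ℝ φ (circleMap 0 r θ) (circleMap 0 r θ)) := by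
      intro r hr
      rw [fk_circleMap k hr.1]
      ring
    exact (setIntegral_congr_fun measurableSet_Ioo this).trans <| by
      rw [integral_const_mul, integral_Ioo_radial hφ1 hs, mul_zero, Pi.zero_apply]
  rw [integral_add i1 i2] at h0
  rw [e1, e2]
  linarith

/-! ### Fourier modes of harmonic functions -/

theorem integral_Ioo_circleMap (h : ℂ → ℝ) (r : ℝ) :
    ∫ θ in Set.Ioo (-Real.pi) Real.pi, h (circleMap 0 r θ)
      = 2 * Real.pi * Real.circleAverage h 0 r := by
  have hper : (fun θ ↦ h (circleMap 0 r θ)).Periodic (2 * Real.pi) :=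
    fun x ↦ by simp [periodic_circleMap 0 r x]
  have h2 := hper.intervalIntegral_add_eq (-Real.pi) 0
  rw [show -Real.pi + 2 * Real.pi = Real.pi by ring, zero_add] at h2
  rw [← integral_Ioc_eq_integral_Ioo,
    ← intervalIntegral.integral_of_le (by linarith [Real.pi_pos]), h2, Real.circleAverage_def,
    smul_eq_mul]
  field_simp

/-- Mean value property: the average is the value at the centre, where `z ^ n` vanishes. -/
theorem circleAverage_mul_pow_eq_zero {F : ℂ → ℂ} (hF : AnalyticOnNhd ℂ F disk) {n : ℕ}
    (hn : n ≠ 0) {r : ℝ} (hr : r ∈ Set.Ioo (0 : ℝ) 1) :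
    Real.circleAverage (fun z ↦ F z * z ^ n) 0 r = 0 := by
  have hd : DifferentiableOn ℂ (fun z ↦ F z * z ^ n) disk :=
    hF.differentiableOn.mul (differentiableOn_pow n)
  have hsub : closedBall (0 : ℂ) |r| ⊆ disk := by
    rw [abs_of_pos hr.1]
    exact closedBall_subset_ball hr.2
  have := circleAverage_of_differentiable_on_off_countable (c := 0) (R := r) Set.countable_empty
    (hd.continuousOn.mono hsub) fun z hz ↦
      hd.differentiableAt (isOpen_ball.mem_nhds (hsub (ball_subset_closedBall hz.1)))
  rw [this, zero_pow hn, mul_zero]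

theorem differentiableOn_mul_inv_pow {F : ℂ → ℂ} (hF : AnalyticOnNhd ℂ F disk) (n : ℕ) :
    DifferentiableOn ℂ (fun z ↦ F z * z⁻¹ ^ n) (disk \ {0}) :=
  (hF.differentiableOn.mono Set.sdiff_subset).mul
    ((differentiableOn_inv.mono fun _ hz ↦ hz.2).pow n)

/-- Cauchy's theorem on the annulus between the two circles; the common value is the `n`-th Taylor
coefficient of `F`. -/
theorem circleAverage_mul_inv_pow_eq {F : ℂ → ℂ} (hF : AnalyticOnNhd ℂ F disk) (n : ℕ)
    {r s : ℝ} (hr : 0 < r) (hrs : r ≤ s) (hs : s < 1) :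
    Real.circleAverage (fun z ↦ F z * z⁻¹ ^ n) 0 s
      = Real.circleAverage (fun z ↦ F z * z⁻¹ ^ n) 0 r := by
  have hd := differentiableOn_mul_inv_pow hF n
  rw [Real.circleAverage_eq_circleIntegral (hr.trans_le hrs).ne',
    Real.circleAverage_eq_circleIntegral hr.ne']
  congr 1
  refine Complex.circleIntegral_sub_center_inv_smul_eq_of_differentiable_on_annulus_off_countable
    hr hrs Set.countable_empty (hd.continuousOn.mono ?_) fun z hz ↦ hd.differentiableAt ?_
  · rintro z ⟨h1, h2⟩
    refine ⟨closedBall_subset_ball hs h1, ?_⟩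
    rintro rfl
    exact h2 (mem_ball_self hr)
  · refine (isOpen_ball.sdiff isClosed_singleton).mem_nhds
      ⟨closedBall_subset_ball hs (ball_subset_closedBall hz.1.1), ?_⟩
    rintro rfl
    exact hz.1.2 (mem_closedBall_self hr.le)

/-- Write `u = Re F` with `F` holomorphic, so `u Re z^n = ½ Re (F z^n + F z̄^n)`. The first term
averages to zero. On `|z| = r` one has `z̄ = r²/z`, so the second is `r^(2n) F z^(-n)`, whose
average is `r^(2n)` times a Taylor coefficient. -/
theorem exists_circleAverage_harmonic_mul_pow_re {u : ℂ → ℝ} (hu : HarmonicOnNhd u disk)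
    {n : ℕ} (hn : n ≠ 0) :
    ∃ a : ℝ, ∀ r ∈ Set.Ioo (0 : ℝ) 1,
      Real.circleAverage (fun z ↦ u z * (z ^ n).re) 0 r = a * r ^ (2 * n) := by
  obtain ⟨F, hF, hFu⟩ := hu.exists_analyticOnNhd_ball_re_eq
  -- The radius `1/2` is arbitrary, since the average does not depend on it.
  set K : ℂ := Real.circleAverage (fun z ↦ F z * z⁻¹ ^ n) 0 (1 / 2)
  refine ⟨K.re / 2, fun r hr ↦ ?_⟩
  have hKr : Real.circleAverage (fun z ↦ F z * z⁻¹ ^ n) 0 r = K := by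
    rcases le_total r (1 / 2) with h | h
    · exact (circleAverage_mul_inv_pow_eq hF n hr.1 h (by norm_num)).symm
    · exact circleAverage_mul_inv_pow_eq hF n (by norm_num) h hr.2
  have hsph : sphere (0 : ℂ) |r| ⊆ disk \ {0} := by
    intro z hz
    have hz : ‖z‖ = r := by simpa [abs_of_pos hr.1] using hz
    refine ⟨by simpa [hz] using hr.2, ?_⟩
    rintro rfl
    simp [hr.1.ne] at hz
  have i1 : CircleIntegrable (fun z ↦ F z * z ^ n) 0 r :=
    ((hF.continuousOn.mono (hsph.trans Set.sdiff_subset)).mul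
      (continuous_pow n).continuousOn).circleIntegrable'
  have i2 : CircleIntegrable (fun z ↦ F z * z⁻¹ ^ n) 0 r :=
    ((differentiableOn_mul_inv_pow hF n).continuousOn.mono hsph).circleIntegrable'
  have i3 : CircleIntegrable (fun z ↦ ((r ^ (2 * n) : ℝ) : ℂ) • (F z * z⁻¹ ^ n)) 0 r :=
    i2.const_smul
  have e : Set.EqOn (fun z ↦ u z * (z ^ n).re)
      (((1 / 2 : ℝ) • Complex.reCLM) ∘
        fun z ↦ F z * z ^ n + ((r ^ (2 * n) : ℝ) : ℂ) • (F z * z⁻¹ ^ n)) (sphere 0 |r|) := by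
    intro z hz
    have hz0 : z ≠ 0 := (hsph hz).2
    have hzu := hFu (hsph hz).1
    have hz' : ‖z‖ = r := by simpa [abs_of_pos hr.1] using hz
    have hconj : ((r ^ (2 * n) : ℝ) : ℂ) * z⁻¹ ^ n = (starRingEnd ℂ) (z ^ n) := by
      have : (r : ℂ) ^ 2 * z⁻¹ = (starRingEnd ℂ) z := by
        rw [← hz', ← Complex.mul_conj', mul_comm z, mul_assoc, mul_inv_cancel₀ hz0, mul_one]
      rw [map_pow, ← this, mul_pow, ← pow_mul, Complex.ofReal_pow]
    have : ((r ^ (2 * n) : ℝ) : ℂ) • (F z * z⁻¹ ^ n) = F z * (starRingEnd ℂ) (z ^ n) := by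
      rw [smul_eq_mul, ← hconj]
      ring
    simp only [Function.comp_apply, this, ← hzu, ← mul_add, Complex.add_conj]
    simp only [smul_apply, Complex.reCLM_apply, smul_eq_mul, Complex.mul_re,
      Complex.ofReal_re, Complex.ofReal_im, mul_zero, sub_zero]
    ring
  rw [Real.circleAverage_congr_sphere e, ContinuousLinearMap.circleAverage_comp_comm _ (by exact i1.add i3),
    Real.circleAverage_fun_add i1 i3, circleAverage_mul_pow_eq_zero hF hn hr,
    Real.circleAverage_fun_smul, hKr]
  simp only [zero_add, smul_apply, Complex.reCLM_apply, smul_eq_mul,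
    Complex.re_ofReal_mul]
  ring

/-! ### The projection of `fk` -/

/-- The coefficient of `Re (z ^ (k + 1))` in the projection of `fk k`. -/
noncomputable def projCoeff (k : ℕ) : ℝ := 2 * ((k : ℝ) + 2) / ((k : ℝ) + 4)

theorem one_le_projCoeff (k : ℕ) : 1 ≤ projCoeff k := by
  rw [projCoeff, le_div_iff₀ (by positivity)]
  linarith [(k.cast_nonneg : (0 : ℝ) ≤ k)]

/-- The projection of `fk k` as a function on the plane. -/
noncomputable def projFk (k : ℕ) (z : ℂ) : ℝ := projCoeff k * (z ^ (k + 1)).re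

theorem contDiff_projFk (k : ℕ) : ContDiff ℝ 1 (projFk k) :=
  contDiff_const.mul (Complex.reCLM.contDiff.comp (contDiff_id.pow (k + 1)))

theorem memLp_projFk (k : ℕ) : MemLp (projFk k) 2 (volume.restrict disk) :=
  memLp_of_continuous (contDiff_projFk k).continuous

theorem harmonicOnNhd_projFk (k : ℕ) : HarmonicOnNhd (projFk k) disk := by
  intro z _
  have h : AnalyticAt ℂ (fun w : ℂ ↦ w ^ (k + 1)) z := analyticAt_id.pow (k + 1)
  exact h.harmonicAt_re.const_smul (c := projCoeff k)

theorem fderiv_projFk (k : ℕ) (z v : ℂ) :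
    fderiv ℝ (projFk k) z v = projCoeff k * ((k : ℝ) + 1) * (z ^ k * v).re := by
  have h1 : HasFDerivAt (fun w : ℂ ↦ w ^ (k + 1)) _ z :=
    ((hasDerivAt_pow (k + 1) z).hasFDerivAt).restrictScalars ℝ
  have h2 : HasFDerivAt (projFk k) _ z :=
    (Complex.reCLM.hasFDerivAt.comp z h1).const_mul (projCoeff k)
  rw [h2.fderiv]
  have : v * (((k : ℂ) + 1) * z ^ k) = (((k : ℝ) + 1 : ℝ) : ℂ) * (z ^ k * v) := by
    push_cast
    ring
  have hre : (v * (((k : ℂ) + 1) * z ^ k)).re = ((k : ℝ) + 1) * (z ^ k * v).re := by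
    rw [this, Complex.re_ofReal_mul]
  simp [hre, -Complex.mul_re, mul_assoc]

/-- On each circle `fk k` is `r^(-k) Re z^(k+1)`, so only one Fourier mode of `u` enters. The
remaining radial integral is proportional to `1/(k+4) - c/(2k+4)`, which determines `c = projCoeff
k`. -/
theorem integral_harmonic_mul_sub_eq_zero {u : ℂ → ℝ} (hu : HarmonicOnNhd u disk)
    (hu2 : MemLp u 2 (volume.restrict disk)) (k : ℕ) :
    ∫ z in disk, u z * (fk k z - projFk k z) = 0 := by
  obtain ⟨a, ha⟩ := exists_circleAverage_harmonic_mul_pow_re hu k.succ_ne_zero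
  have hi : IntegrableOn (fun z ↦ u z * (fk k z - projFk k z)) disk :=
    hu2.integrable_mul ((memLp_fk k).sub (memLp_projFk k))
  rw [integral_disk_polar hi]
  have key : ∀ r ∈ Set.Ioo (0 : ℝ) 1, ∫ θ in Set.Ioo (-Real.pi) Real.pi,
      r * (u (circleMap 0 r θ) * (fk k (circleMap 0 r θ) - projFk k (circleMap 0 r θ)))
      = 2 * Real.pi * a * (r ^ (k + 3) - projCoeff k * r ^ (2 * k + 3)) := by
    intro r hr
    have e : ∀ θ, r * (u (circleMap 0 r θ) *
        (fk k (circleMap 0 r θ) - projFk k (circleMap 0 r θ))) =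
        (r * (1 / r ^ k - projCoeff k)) *
          (fun z ↦ u z * (z ^ (k + 1)).re) (circleMap 0 r θ) := by
      intro θ
      rw [fk_eq, projFk, norm_circleMap_zero, abs_of_pos hr.1]
      ring
    simp_rw [e]
    rw [integral_const_mul, integral_Ioo_circleMap (fun z ↦ u z * (z ^ (k + 1)).re), ha r hr]
    have := hr.1.ne'
    field_simp
    simp only [Nat.succ_eq_add_one]
    ring
  have p : ∀ m : ℕ, IntegrableOn (fun r : ℝ ↦ r ^ m) (Set.Ioo 0 1) := fun m ↦
    ((continuous_pow m).continuousOn.integrableOn_compact isCompact_Icc).mono_set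
      Set.Ioo_subset_Icc_self
  rw [setIntegral_congr_fun measurableSet_Ioo key, integral_const_mul,
    integral_sub (p _) ((p _).const_mul _), integral_const_mul, integral_Ioo_pow,
    integral_Ioo_pow, projCoeff]
  push_cast
  field_simp
  ring

theorem P_fk (k : ℕ) :
    P ((memLp_fk k).toLp (fk k)) = (memLp_projFk k).toLp (projFk k) := by
  refine Submodule.eq_starProjection_of_mem_of_inner_eq_zero
    ⟨projFk k, harmonicOnNhd_projFk k, (memLp_projFk k).coeFn_toLp⟩ ?_
  rintro w ⟨u, hu, hwu⟩
  have hu2 : MemLp u 2 (volume.restrict disk) := (Lp.memLp w).ae_eq hwu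
  rw [L2.inner_def, ← integral_harmonic_mul_sub_eq_zero hu hu2 k]
  refine integral_congr_ae ?_
  filter_upwards [hwu, (memLp_fk k).coeFn_toLp, (memLp_projFk k).coeFn_toLp,
    Lp.coeFn_sub ((memLp_fk k).toLp (fk k)) ((memLp_projFk k).toLp (projFk k))] with z h1 h2 h3 h4
  rw [h4, h1, Pi.sub_apply, h2, h3]
  simp

/-! ### Sobolev norms of the projections and failure of the estimate -/

theorem memLp_fderiv_projFk (k : ℕ) (v : ℂ) :
    MemLp (fun z ↦ fderiv ℝ (projFk k) z v) 2 (volume.restrict disk) :=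
  memLp_of_continuous
    (((contDiff_projFk k).continuous_fderiv one_ne_zero).clm_apply continuous_const)

theorem hasDistribDeriv_projFk (k : ℕ) (v : ℂ) :
    HasDistribDeriv (fun _ ↦ v) ((memLp_projFk k).toLp (projFk k))
      ((memLp_fderiv_projFk k v).toLp _) :=
  hasDistribDeriv_const_of_contDiff (contDiff_projFk k) v (memLp_projFk k).coeFn_toLp
    (memLp_fderiv_projFk k v).coeFn_toLp

theorem memH1_projFk (k : ℕ) : MemH1 ((memLp_projFk k).toLp (projFk k)) :=
  ⟨⟨_, hasDistribDeriv_projFk k 1⟩, ⟨_, hasDistribDeriv_projFk k Complex.I⟩⟩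

/-- Only `∂₁` is kept: it equals `projCoeff k * (k+1) Re z^k`, and `‖Re z^k‖² = π/(2k+2)` with
`projCoeff k ≥ 1`. For `k = 0` the last norm is different, because `cos 0` has mean square `1`
rather than `1/2`. -/
theorem le_sobolevNorm_sq_projFk {k : ℕ} (hk : 1 ≤ k) :
    Real.pi * ((k : ℝ) + 1) / 2 ≤ sobolevNorm ((memLp_projFk k).toLp (projFk k)) ^ 2 := by
  have hg : MemLp (fun z : ℂ ↦ (z ^ k).re) 2 (volume.restrict disk) :=
    memLp_of_continuous (Complex.continuous_re.comp (continuous_pow k))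
  have hg2 : ∫ z in disk, (z ^ k).re ^ 2 = Real.pi / (2 * (k : ℝ) + 2) := by
    rw [← norm_sq_toLp hg, norm_sq_toLp_of_polar hg (by omega)
      (fun r _ θ ↦ circleMap_zero_pow_re r θ k)]
  have hX : distribDeriv X₁ ((memLp_projFk k).toLp (projFk k))
      = (memLp_fderiv_projFk k 1).toLp _ := (hasDistribDeriv_projFk k 1).distribDeriv_eq
  have hn : ‖distribDeriv X₁ ((memLp_projFk k).toLp (projFk k))‖ ^ 2
      = projCoeff k ^ 2 * (Real.pi * ((k : ℝ) + 1) / 2) := by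
    rw [hX, norm_sq_toLp]
    simp_rw [fderiv_projFk, mul_one, mul_pow _ (Complex.re _)]
    rw [integral_const_mul, hg2]
    field_simp
  rw [sobolevNorm, Real.sq_sqrt (by positivity), hn]
  have h1 : 1 ≤ projCoeff k ^ 2 := one_le_pow₀ (one_le_projCoeff k)
  have h2 : 0 ≤ Real.pi * ((k : ℝ) + 1) / 2 := by positivity
  nlinarith [sq_nonneg ‖(memLp_projFk k).toLp (projFk k)‖,
    sq_nonneg ‖distribDeriv X₂ ((memLp_projFk k).toLp (projFk k))‖,
    mul_le_mul_of_nonneg_right h1 h2]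

theorem not_exists_bound_fk :
    ¬ ∃ C : ℝ, ∀ k : ℕ, 1 ≤ k →
      sobolevNorm (P ((memLp_fk k).toLp (fk k))) ≤
        C * (‖distribDeriv N ((memLp_fk k).toLp (fk k))‖ + ‖(memLp_fk k).toLp (fk k)‖) := by
  rintro ⟨C, hC⟩
  -- Squaring the bound gives `π(k+1)/2 ≤ C² π`, impossible once `k > 2C²`; the extra `1` secures `k
  -- ≥ 1`.
  obtain ⟨k, hk⟩ := exists_nat_gt (2 * C ^ 2 + 1)
  have hk1 : 1 ≤ k := by
    have : (1 : ℝ) < k := by nlinarith [sq_nonneg C]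
    exact_mod_cast this.le
  have h := hC k hk1
  rw [(hasDistribDeriv_N_fk k).distribDeriv_eq, norm_fk, P_fk, add_halves] at h
  have h2 := pow_le_pow_left₀ (Real.sqrt_nonneg _) h 2
  rw [mul_pow, Real.sq_sqrt Real.pi_pos.le] at h2
  have h3 := (le_sobolevNorm_sq_projFk hk1).trans h2
  nlinarith [Real.pi_pos]

end HarmonicBergman

theorem mainTheorem5 :
    ∃ hf : ∀ k : ℕ, MemLp (fk k) 2 (volume.restrict disk),
      (∀ k : ℕ,
        (∀ z : ℂ, z ≠ 0 → DifferentiableAt ℝ (fk k) z ∧ fderiv ℝ (fk k) z (N z) = fk k z) ∧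
        HasDistribDeriv N ((hf k).toLp (fk k)) ((hf k).toLp (fk k)) ∧
        ‖(hf k).toLp (fk k)‖ = Real.sqrt Real.pi / 2 ∧
        P ((hf k).toLp (fk k)) =ᵐ[volume.restrict disk]
          (fun z : ℂ ↦ 2 * ((k : ℝ) + 2) / ((k : ℝ) + 4) * (z ^ (k + 1)).re) ∧
        MemH1 (P ((hf k).toLp (fk k)))) ∧
      (¬ ∃ C : ℝ, ∀ k : ℕ, 1 ≤ k →
        sobolevNorm (P ((hf k).toLp (fk k))) ≤
          C * (‖distribDeriv N ((hf k).toLp (fk k))‖ + ‖(hf k).toLp (fk k)‖)) ∧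
      ¬ ∃ C : ℝ, ∀ f : L2Disk, (∃ g, HasDistribDeriv N f g) → MemH1 (P f) →
        sobolevNorm (P f) ≤ C * (‖distribDeriv N f‖ + ‖f‖) := by
  refine ⟨memLp_fk, fun k ↦ ⟨fun z hz ↦ ⟨differentiableAt_fk k hz, fderiv_fk_self k hz⟩,
    hasDistribDeriv_N_fk k, norm_fk k, ?_, ?_⟩, not_exists_bound_fk, ?_⟩
  · rw [P_fk]
    exact (memLp_projFk k).coeFn_toLp
  · rw [P_fk]
    exact memH1_projFk k
  · rintro ⟨C, hC⟩
    refine not_exists_bound_fk ⟨C, fun k _ ↦ hC _ ⟨_, hasDistribDeriv_N_fk k⟩ ?_⟩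
    rw [P_fk]
    exact memH1_projFk k
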